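/- All spaces are crowded (they have no isolated points). A continuous map $f : X \to Y$ is \emph{nowhere constant} if $|f[U]| > 1$ for every non-empty open $U \subseteq X$. Let $w(Y)$ denote the weight of $Y$ (the least cardinality of a base), and let $\widehat{c}(X)$ be the smallest cardinal $\kappa$ such that $X$ has no family of $\kappa$ many pairwise disjoint non-empty open sets. A \emph{shattering family} for $X$ is a collection $\mathfrak{F}$ of families $\mathcal{S}$ of pairwise disjoint non-empty regular open subsets of $X$ such that every non-empty open $U \subseteq X$ meets at least two members of some $\mathcal{S} \in \mathfrak{F}$; the \emph{shattering number} $\mathrm{sh}(X)$ is the least cardinality of a shattering family for $X$. A \emph{$\kappa$-Suslin tree} is a tree of cardinality $\kappa$ all of whose chains and antichains have cardinality less than $\kappa$. \textbf{Theorem.} Let $X$ be a crowded Tychonov space. (1) There are a crowded Tychonov space $Y$ and a nowhere constant continuous surjection $X \to Y$ such that $w(Y) \le \widehat{c}(X)$. (2) If $\mathrm{sh}(X) < \widehat{c}(X)$, then there are a crowded Tychonov space $Y$ and a nowhere constant continuous surjection $X \to Y$ such that $w(Y) < \widehat{c}(X)$. (3) If there is no $\widehat{c}(X)$-Suslin tree,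 then $\mathrm{sh}(X) < \widehat{c}(X)$; in particular $Y$ can then be chosen as in (2). -/

import Mathlib

open Cardinal Set TopologicalSpace

universe u

namespace NowhereConst

/-- A continuous map that is not constant on any non-empty open subset of its domain. -/
structure IsNWC {X Y : Type*} [TopologicalSpace X] [TopologicalSpace Y] (f : X → Y) : Prop where
  continuous : Continuous f
  nontrivial_image : ∀ U : Set X, IsOpen U → U.Nonempty → (f '' U).Nontrivial

/-- `Y` is a crowded Tychonov space that is the image of `X` under a nowhere constant
continuous map. -/
structure IsTychonovNWCImage (X : Type*) [TopologicalSpace X] (Y : Type*) [TopologicalSpace Y] :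
    Prop where
  tychonov : T35Space Y
  crowded : PerfectSpace Y
  exists_map : ∃ f : X → Y, IsNWC f ∧ Function.Surjective f

/-- The weight `w(X)`: the least cardinality of a base of the topology. -/
noncomputable def weight (X : Type u) [TopologicalSpace X] : Cardinal.{u} :=
  sInf {κ | ∃ B : Set (Set X), IsTopologicalBasis B ∧ #B = κ}

/-- A disjoint family of non-empty open sets. -/
structure IsCellular {X : Type*} [TopologicalSpace X] (S : Set (Set X)) : Prop where
  isOpen : ∀ U ∈ S, IsOpen U
  nonempty : ∀ U ∈ S, U.Nonempty
  disjoint : S.PairwiseDisjoint id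

/-- The hat version `ĉ(X)` of cellularity: the least cardinal `κ` such that no disjoint family of
non-empty open sets of `X` has cardinality `κ`. -/
noncomputable def hatCellularity (X : Type u) [TopologicalSpace X] : Cardinal.{u} :=
  sInf {κ | ¬ ∃ S : Set (Set X), IsCellular S ∧ #S = κ}

/-- A set `U` with `U = int (cl U)`. -/
def IsRegularOpen {X : Type*} [TopologicalSpace X] (U : Set X) : Prop :=
  interior (closure U) = U

/-- A shattering family for `X`: a collection of disjoint families of non-empty regular open sets
such that every non-empty open set meets at least two members of some family in the collection. -/
structure IsShattering {X : Type*} [TopologicalSpace X] (F : Set (Set (Set X))) : Prop where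
  isCellular : ∀ S ∈ F, IsCellular S
  isRegularOpen : ∀ S ∈ F, ∀ R ∈ S, IsRegularOpen R
  shatters : ∀ U : Set X, IsOpen U → U.Nonempty →
    ∃ S ∈ F, ∃ R₁ ∈ S, ∃ R₂ ∈ S, R₁ ≠ R₂ ∧ (U ∩ R₁).Nonempty ∧ (U ∩ R₂).Nonempty

/-- The shattering number `sh(X)`: the least cardinality of a shattering family for `X`. (The set
of these cardinalities is non-empty for every crowded Hausdorff space.) -/
noncomputable def shatteringNumber (X : Type u) [TopologicalSpace X] : Cardinal.{u} :=
  sInf {κ | ∃ F : Set (Set (Set X)), IsShattering F ∧ #F = κ}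

/-- A `κ`-Suslin tree: a partial order in which the predecessors of every element are well-ordered,
of cardinality `κ`, all of whose chains and antichains have cardinality less than `κ`. (For regular
infinite `κ`, in place of the cardinality one may equivalently ask that the height be `κ`.) -/
structure IsSuslinTree (κ : Cardinal.{u}) (T : Type u) [PartialOrder T] : Prop where
  isWellOrder_Iio : ∀ t : T, IsWellOrder (Iio t) (· < ·)
  card_eq : #T = κ
  card_chain_lt : ∀ C : Set T, IsChain (· ≤ ·) C → #C < κ
  card_antichain_lt : ∀ A : Set T, IsAntichain (· ≤ ·) A → #A < κ

end NowhereConst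

/-! A shattering family becomes a map into a power of `ℝ`. Refine each of its disjoint families to
disjoint cozero sets and take one function per cozero set. If an open `U` meets two members of a
family, some function is non-zero at a point of `U` in the first and vanishes on the second. The
weight of the image is at most the number of functions (or `ℵ₀`), a sum of cardinals below `ĉ(X)`.
With at most `ĉ(X)` summands this is at most `ĉ(X)`; with fewer it is below `ĉ(X)`, by Erdős–Tarski
(`sum_lt_hatCellularity_of_lt`).

A shattering family of size at most `ĉ(X)` comes from halving regular open sets transfinitely. The
non-empty sets obtained form a tree (`nodes`). Its antichains are disjoint families, and a chain
yields a disjoint family from the halves it leaves behind, so both are smaller than `ĉ(X)`. Hence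
the tree has size at most `ĉ(X)`, and equality makes it a Suslin tree. The pairs of halves shatter
`X`: an open set never split would follow a branch of ordinal length without end. -/

namespace NowhereConst

/-! ### Disjoint families and the Erdős–Tarski theorem -/

section Cellular

variable {X : Type u} [TopologicalSpace X]

/-- Every class of non-empty open sets contains a disjoint family that meets all its members. -/
theorem exists_maximal_cellular (P : Set X → Prop)
    (hP : ∀ V, P V → IsOpen V ∧ V.Nonempty) :
    ∃ S : Set (Set X), IsCellular S ∧ (∀ V ∈ S, P V) ∧
      ∀ V, P V → ∃ W ∈ S, (V ∩ W).Nonempty := by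
  obtain ⟨S, hS⟩ := zorn_subset {S : Set (Set X) | (∀ V ∈ S, P V) ∧ S.PairwiseDisjoint id} (by
    intro c hc hchain
    refine ⟨⋃₀ c, ⟨?_, ?_⟩, fun s hs => subset_sUnion_of_mem hs⟩
    · rintro V ⟨s, hs, hV⟩
      exact (hc hs).1 V hV
    · exact (pairwiseDisjoint_sUnion hchain.directedOn).2 fun s hs => (hc hs).2)
  refine ⟨S, ⟨fun V hV => (hP V (hS.prop.1 V hV)).1, fun V hV => (hP V (hS.prop.1 V hV)).2,
    hS.prop.2⟩, hS.prop.1, fun V hV => ?_⟩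
  by_contra! h
  have hins : insert V S ⊆ S := hS.2 ⟨by
      rintro W (rfl | hW)
      exacts [hV, hS.prop.1 W hW], by
      refine hS.prop.2.insert fun W hW _ => ?_
      exact disjoint_iff_inter_eq_empty.2 (h W hW)⟩ (subset_insert V S)
  have := h V (hins (mem_insert V S))
  rw [inter_self] at this
  exact (hP V hV).2.ne_empty this

theorem IsCellular.subset {S T : Set (Set X)} (hT : IsCellular T) (h : S ⊆ T) : IsCellular S :=
  ⟨fun U hU => hT.isOpen U (h hU), fun U hU => hT.nonempty U (h hU), hT.disjoint.subset h⟩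

/-- The hat version of the cellularity of a subset `U` of `X`. -/
noncomputable def hatCellularityIn (U : Set X) : Cardinal.{u} :=
  sInf {κ | ¬ ∃ S : Set (Set X), (IsCellular S ∧ ∀ V ∈ S, V ⊆ U) ∧ #S = κ}

theorem hatCellularityIn_univ : hatCellularityIn (univ : Set X) = hatCellularity X := by
  simp [hatCellularityIn, hatCellularity]

/-- Subfamilies of disjoint families are disjoint, so the attained cardinals form an initial
segment. `Order.succ #(Set X)` is not attained, so the infimum is a genuine minimum. -/
theorem IsCellular.card_lt_in {U : Set X} {S : Set (Set X)} (hS : IsCellular S)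
    (hSU : ∀ V ∈ S, V ⊆ U) : #S < hatCellularityIn U := by
  have hmem : hatCellularityIn U ∈
      {κ | ¬ ∃ S : Set (Set X), (IsCellular S ∧ ∀ V ∈ S, V ⊆ U) ∧ #S = κ} := by
    refine csInf_mem ⟨Order.succ #(Set X), ?_⟩
    rintro ⟨S, -, hS⟩
    exact (Order.lt_succ #(Set X)).not_ge (hS ▸ mk_set_le S)
  by_contra! h
  obtain ⟨T, hTS, hT⟩ := le_mk_iff_exists_subset.1 h
  exact hmem ⟨T, ⟨hS.subset hTS, fun V hV => hSU V (hTS hV)⟩, hT⟩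

theorem lt_hatCellularityIn_iff {U : Set X} {μ : Cardinal.{u}} :
    μ < hatCellularityIn U ↔
      ∃ S : Set (Set X), (IsCellular S ∧ ∀ V ∈ S, V ⊆ U) ∧ #S = μ := by
  refine ⟨fun h => ?_, ?_⟩
  · by_contra h'
    exact notMem_of_lt_csInf' h h'
  · rintro ⟨S, ⟨hS, hSU⟩, rfl⟩
    exact hS.card_lt_in hSU

theorem IsCellular.card_lt {S : Set (Set X)} (hS : IsCellular S) : #S < hatCellularity X := by
  rw [← hatCellularityIn_univ]
  exact hS.card_lt_in fun V _ => subset_univ V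

theorem hatCellularityIn_pos (U : Set X) : 0 < hatCellularityIn U :=
  lt_hatCellularityIn_iff.2 ⟨∅, ⟨⟨by simp, by simp, by simp⟩, by simp⟩, by simp⟩

/-- Disjoint families inside the members of a disjoint family can be put together. -/
theorem sum_lt_hatCellularity {ι : Type u} {U : ι → Set X}
    (hU : Pairwise (Function.onFun Disjoint U)) {d : ι → Cardinal.{u}}
    (hd : ∀ i, d i < hatCellularityIn (U i)) : Cardinal.sum d < hatCellularity X := by
  choose S hS hcard using fun i => lt_hatCellularityIn_iff.1 (hd i)
  have hdisj : ∀ i j, i ≠ j → ∀ V ∈ S i, ∀ W ∈ S j, Disjoint V W := fun i j hij V hV W hW =>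
    (hU hij).mono ((hS i).2 V hV) ((hS j).2 W hW)
  have hcell : IsCellular (⋃ i, S i) := by
    refine ⟨?_, ?_, ?_⟩
    · simp only [mem_iUnion]
      rintro V ⟨i, hV⟩
      exact (hS i).1.isOpen V hV
    · simp only [mem_iUnion]
      rintro V ⟨i, hV⟩
      exact (hS i).1.nonempty V hV
    · intro V hV W hW hVW
      obtain ⟨i, hV⟩ := mem_iUnion.1 hV
      obtain ⟨j, hW⟩ := mem_iUnion.1 hW
      by_cases hij : i = j
      · subst hij
        exact (hS i).1.disjoint hV hW hVW
      · exact hdisj i j hij V hV W hW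
  have hSd : Pairwise (Function.onFun Disjoint S) := fun i j hij => by
    refine Set.disjoint_left.2 fun V hV hV' => ?_
    exact ((hS i).1.nonempty V hV).ne_empty (disjoint_self.1 (hdisj i j hij V hV V hV'))
  have := hcell.card_lt
  rw [mk_iUnion_eq_sum_mk hSd] at this
  simpa only [hcard] using this

theorem card_le_of_fiber_le {α β : Type u} (g : α → β) {μ : Cardinal.{u}}
    (h : ∀ b, #{a // g a = b} ≤ μ) : #α ≤ #β * μ := by
  rw [← mk_congr (Equiv.sigmaFiberEquiv g), mk_sigma, ← sum_const']
  exact sum_le_sum _ _ h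

/-- If the members of a family that meets every open set have bounded cellularity, then the
cellularity of the space is bounded. -/
theorem IsCellular.card_le_mul {S C : Set (Set X)} (hC : IsCellular C) {μ : Cardinal.{u}}
    (hSo : ∀ U ∈ S, IsOpen U) (hmeet : ∀ V ∈ C, ∃ U ∈ S, (V ∩ U).Nonempty)
    (hμ : ∀ U ∈ S, hatCellularityIn U ≤ μ) : #C ≤ #S * μ := by
  -- Assign to each `V ∈ C` a member of `S` that it meets. The traces on `U` of the sets assigned to
  -- `U` are disjoint, so there are fewer than `hatCellularityIn U` of them.
  choose! g hgS hg using hmeet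
  refine card_le_of_fiber_le (fun V : C => (⟨g V, hgS V V.2⟩ : S)) fun U => ?_
  let D := {V : C // (⟨g V, hgS V V.2⟩ : S) = U}
  have hne : ∀ V : D, ((V : Set X) ∩ U).Nonempty := fun V => by
    have := hg V.1 V.1.2
    rwa [show g V.1 = U from congrArg Subtype.val V.2] at this
  have hdis : ∀ V W : D, V ≠ W → Disjoint ((V : Set X) ∩ U) ((W : Set X) ∩ U) := fun V W hVW =>
    (hC.disjoint V.1.2 W.1.2 fun h => hVW (Subtype.ext (Subtype.ext h))).mono
      inter_subset_left inter_subset_left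
  have hinj : Function.Injective fun V : D => (V : Set X) ∩ U := fun V W hVW => by
    by_contra h
    have h' := hdis V W h
    have hVW : (V : Set X) ∩ U = (W : Set X) ∩ U := hVW
    rw [hVW] at h'
    exact (hne W).ne_empty (disjoint_self.1 h')
  have hcell : IsCellular (range fun V : D => (V : Set X) ∩ U) := by
    refine ⟨?_, ?_, ?_⟩
    · rintro _ ⟨V, rfl⟩
      exact (hC.isOpen V.1 V.1.2).inter (hSo U U.2)
    · rintro _ ⟨V, rfl⟩
      exact hne V
    · rintro _ ⟨V, rfl⟩ _ ⟨W, rfl⟩ hVW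
      exact hdis V W fun h => hVW (by rw [h])
  have := hcell.card_lt_in (U := (U : Set X)) (by
    rintro _ ⟨V, rfl⟩
    exact inter_subset_right)
  rw [mk_range_eq _ hinj] at this
  exact this.le.trans (hμ U U.2)

/-- The Erdős–Tarski theorem, for infinite disjoint families: the hat version of cellularity is not
a sum of fewer smaller cardinals. -/
theorem sum_lt_hatCellularity_of_lt (hω : ℵ₀ < hatCellularity X) {ι : Type u}
    (hι : #ι < hatCellularity X) {f : ι → Cardinal.{u}} (hf : ∀ i, f i < hatCellularity X) :
    Cardinal.sum f < hatCellularity X := by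
  -- If cellularity drops nowhere inside `U`, cut `U` into `#ι` disjoint pieces and place `f i`
  -- disjoint sets in the `i`-th.
  by_cases hA : ∃ U : Set X, IsOpen U ∧ U.Nonempty ∧
      ∀ V ⊆ U, IsOpen V → V.Nonempty → hatCellularity X ≤ hatCellularityIn V
  · obtain ⟨U, hUo, hUne, hU⟩ := hA
    obtain ⟨S, ⟨hS, hSU⟩, hcard⟩ :=
      lt_hatCellularityIn_iff.1 (hι.trans_le (hU U Subset.rfl hUo hUne))
    obtain ⟨e⟩ := Cardinal.eq.1 hcard.symm
    refine sum_lt_hatCellularity (U := fun i => (e i : Set X)) (fun i j hij => ?_) fun i =>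
      (hf i).trans_le (hU _ (hSU _ (e i).2) (hS.isOpen _ (e i).2) (hS.nonempty _ (e i).2))
    exact hS.disjoint (e i).2 (e j).2 fun h => hij (e.injective (Subtype.ext h))
  push Not at hA
  obtain ⟨S, hS, hSκ, hSmax⟩ := exists_maximal_cellular
    (fun V : Set X => (IsOpen V ∧ V.Nonempty) ∧ hatCellularityIn V < hatCellularity X)
    fun V hV => hV.1
  have hmeet : ∀ V : Set X, IsOpen V → V.Nonempty → ∃ U ∈ S, (V ∩ U).Nonempty := by
    intro V hVo hVne
    obtain ⟨W, hWV, hWo, hWne, hW⟩ := hA V hVo hVne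
    obtain ⟨U, hU, hWU⟩ := hSmax W ⟨⟨hWo, hWne⟩, hW⟩
    exact ⟨U, hU, hWU.mono (inter_subset_inter_left _ hWV)⟩
  -- A bound `μ` forces `ĉ(X)` to be the successor of the infinite cardinal `ν`, hence regular.
  by_cases hB : ∃ μ < hatCellularity X, ∀ U ∈ S, hatCellularityIn U ≤ μ
  · obtain ⟨μ, hμκ, hμ⟩ := hB
    let ν := max (max #S μ) ℵ₀
    have hν : ν < hatCellularity X := max_lt (max_lt hS.card_lt hμκ) hω
    have hle : hatCellularity X ≤ Order.succ ν := by
      by_contra! h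
      rw [← hatCellularityIn_univ] at h
      obtain ⟨C, ⟨hC, -⟩, hcard⟩ := lt_hatCellularityIn_iff.1 h
      have h1 : #C ≤ #S * μ := hC.card_le_mul hS.isOpen
        (fun V hV => hmeet V (hC.isOpen V hV) (hC.nonempty V hV)) hμ
      have h2 : #S * μ ≤ ν := (mul_le_mul' ((le_max_left _ _).trans (le_max_left _ _))
        ((le_max_right _ _).trans (le_max_left _ _))).trans (mul_eq_self (le_max_right _ _)).le
      exact (Order.lt_succ ν).not_ge (hcard ▸ h1.trans h2)
    have heq : hatCellularity X = Order.succ ν := hle.antisymm (Order.succ_le_of_lt hν)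
    rw [heq] at hι hf ⊢
    exact sum_lt_of_isRegular (isRegular_succ (le_max_right _ _)) hι hf
  push Not at hB
  exfalso
  -- In the unbounded case, the value at `U` need not be attained inside `U`, but it is attained
  -- inside `next U`, whose value is the next larger one. Placing `d V` sets in each `V` gives a sum
  -- below `ĉ(X)` that dominates every value, against unboundedness.
  have hnext : ∀ U : S, ∃ V : S, hatCellularityIn (U : Set X) < hatCellularityIn (V : Set X) ∧
      ∀ W : S, hatCellularityIn (U : Set X) < hatCellularityIn (W : Set X) →
        hatCellularityIn (V : Set X) ≤ hatCellularityIn (W : Set X) := by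
    intro U
    obtain ⟨V₀, hV₀, h₀⟩ := hB _ (hSκ U U.2).2
    obtain ⟨V, hV, hmin⟩ := (InvImage.wf (fun V : S => hatCellularityIn (V : Set X))
      Cardinal.lt_wf).has_min
      {V : S | hatCellularityIn (U : Set X) < hatCellularityIn (V : Set X)} ⟨⟨V₀, hV₀⟩, h₀⟩
    exact ⟨V, hV, fun W hW => not_lt.1 (hmin W hW)⟩
  choose next hlt hmin using hnext
  have hd : ∀ V : S, ∃ d < hatCellularityIn (V : Set X),
      ∀ U, next U = V → hatCellularityIn (U : Set X) ≤ d := by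
    intro V
    by_cases h : ∃ U, next U = V
    · obtain ⟨U, rfl⟩ := h
      refine ⟨_, hlt U, fun U' hU' => ?_⟩
      by_contra! h
      exact ((hmin U U' h).trans_lt (hlt U')).ne (by rw [hU'])
    · exact ⟨0, hatCellularityIn_pos _, fun U hU => (h ⟨U, hU⟩).elim⟩
  choose d hdlt hd using hd
  have hsum : Cardinal.sum d < hatCellularity X :=
    sum_lt_hatCellularity (U := fun V : S => (V : Set X))
      (fun V W hVW => hS.disjoint V.2 W.2 fun h => hVW (Subtype.ext h)) hdlt
  obtain ⟨U, hU, hUlt⟩ := hB _ hsum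
  exact hUlt.not_ge ((hd _ ⟨U, hU⟩ rfl).trans (le_sum d _))

theorem aleph0_lt_hatCellularity [T2Space X] [Infinite X] : ℵ₀ < hatCellularity X := by
  obtain ⟨U, hUi, hUo, hd⟩ := exists_seq_infinite_isOpen_pairwise_disjoint X
  have hinj : Function.Injective U := fun i j hij => by
    by_contra h
    have h' : Disjoint (U i) (U j) := hd h
    rw [hij] at h'
    exact (hUi j).nonempty.ne_empty (disjoint_self.1 h')
  have hcell : IsCellular (range U) := by
    refine ⟨?_, ?_, ?_⟩
    · rintro _ ⟨i, rfl⟩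
      exact hUo i
    · rintro _ ⟨i, rfl⟩
      exact (hUi i).nonempty
    · rintro _ ⟨i, rfl⟩ _ ⟨j, rfl⟩ h
      exact hd fun hij => h (by rw [hij])
  refine lt_of_le_of_lt ?_ hcell.card_lt
  have := infinite_range_of_injective hinj
  exact aleph0_le_mk_iff.2 this.to_subtype

end Cellular

/-! ### Weight of subspaces of powers of `ℝ` -/

section Weight

theorem weight_le {Y : Type u} [TopologicalSpace Y] {B : Set (Set Y)} (hB : IsTopologicalBasis B) :
    weight Y ≤ #B :=
  csInf_le' ⟨B, hB, rfl⟩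

theorem weight_le_of_subbasis {Y : Type u} [t : TopologicalSpace Y] {s : Set (Set Y)}
    (hs : t = generateFrom s) : weight Y ≤ max #s ℵ₀ := by
  refine (weight_le (isTopologicalBasis_of_subbasis hs)).trans (mk_image_le.trans ?_)
  have h1 : #{f : Set (Set Y) | f.Finite ∧ f ⊆ s} ≤ #(Finset s) := by
    classical
    refine mk_le_of_surjective (f := fun F : Finset s => (⟨Subtype.val '' (F : Set s),
      F.finite_toSet.image _, by rintro _ ⟨x, -, rfl⟩; exact x.2⟩ :
        {f : Set (Set Y) | f.Finite ∧ f ⊆ s})) ?_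
    rintro ⟨f, hf, hfs⟩
    have hfin : (Subtype.val ⁻¹' f : Set s).Finite := hf.preimage Subtype.val_injective.injOn
    refine ⟨hfin.toFinset, Subtype.ext ?_⟩
    simpa using hfs
  refine h1.trans ?_
  cases finite_or_infinite s
  · exact (mk_le_aleph0 (α := Finset s)).trans (le_max_right _ _)
  · rw [mk_finset_of_infinite]
    exact le_max_left _ _

theorem weight_le_of_isInducing_pi {Y I : Type u} [TopologicalSpace Y] {j : Y → I → ℝ}
    (hj : Topology.IsInducing j) : weight Y ≤ max #I ℵ₀ := by
  let s : Set (Set Y) := ⋃ i : I, (fun V => (fun y => j y i) ⁻¹' V) '' countableBasis ℝ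
  have hs : ‹TopologicalSpace Y› = generateFrom s := by
    rw [hj.eq_induced, Pi.topologicalSpace, induced_iInf, generateFrom_iUnion]
    refine iInf_congr fun i => ?_
    rw [induced_compose]
    exact (congrArg (induced _) (isBasis_countableBasis ℝ).eq_generateFrom).trans
      induced_generateFrom_eq
  refine (weight_le_of_subbasis hs).trans (max_le ?_ (le_max_right _ _))
  refine (mk_iUnion_le_sum_mk.trans (sum_le_sum _ (fun _ => ℵ₀) fun i =>
    le_aleph0_iff_set_countable.2 ((countable_countableBasis ℝ).image _))).trans ?_
  rw [sum_const']
  exact (mul_le_max _ _).trans (by simp)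

end Weight

/-! ### From shattering families to nowhere constant images -/

section Image

variable {X : Type u} [TopologicalSpace X]

/-- The preimage of an isolated point would be a non-empty open set with a one-point image. -/
theorem IsNWC.perfectSpace {Y : Type*} [TopologicalSpace Y] {f : X → Y} (hf : IsNWC f)
    (hsurj : Function.Surjective f) : PerfectSpace Y := by
  refine perfectSpace_iff_forall_not_isolated.2 fun y => ?_
  refine ⟨fun h => ?_⟩
  obtain ⟨x, rfl⟩ := hsurj y
  have hopen : IsOpen ({f x} : Set Y) := isOpen_singleton_iff_punctured_nhds (f x) |>.2 h
  obtain ⟨a, ⟨a', ha, rfl⟩, b, ⟨b', hb, rfl⟩, hab⟩ :=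
    hf.nontrivial_image _ (hopen.preimage hf.continuous) ⟨x, rfl⟩
  have ha : f a' = f x := ha
  have hb : f b' = f x := hb
  exact hab (ha.trans hb.symm)

/-- Real functions that are jointly nowhere constant give a Tychonov nowhere constant image. -/
theorem exists_image_of_functions {I : Type u} (g : I → X → ℝ) (hg : ∀ i, Continuous (g i))
    (h : ∀ U : Set X, IsOpen U → U.Nonempty → ∃ i, ∃ x ∈ U, ∃ y ∈ U, g i x ≠ g i y) :
    ∃ (Y : Type u) (_ : TopologicalSpace Y), IsTychonovNWCImage X Y ∧ weight Y ≤ max #I ℵ₀ := by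
  let e : X → I → ℝ := fun x i => g i x
  have hnwc : IsNWC (rangeFactorization e) := by
    refine ⟨(continuous_pi hg).subtype_mk _, fun U hU hne => ?_⟩
    obtain ⟨i, x, hx, y, hy, hxy⟩ := h U hU hne
    exact ⟨_, mem_image_of_mem _ hx, _, mem_image_of_mem _ hy,
      fun h => hxy (congrFun (congrArg Subtype.val h) i)⟩
  exact ⟨range e, inferInstance, ⟨inferInstance, hnwc.perfectSpace rangeFactorization_surjective,
    _, hnwc, rangeFactorization_surjective⟩,
    weight_le_of_isInducing_pi (j := Subtype.val) Topology.IsInducing.subtypeVal⟩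

theorem exists_support_subset [CompletelyRegularSpace X] {U : Set X} (hU : IsOpen U)
    (hne : U.Nonempty) : ∃ g : X → ℝ, Continuous g ∧ (Function.support g).Nonempty ∧
      Function.support g ⊆ U := by
  obtain ⟨x, hx⟩ := hne
  obtain ⟨f, hf, hfx, hfU⟩ := CompletelyRegularSpace.completely_regular_isOpen x U hU hx
  refine ⟨fun y => 1 - f y, continuous_const.sub (continuous_subtype_val.comp hf), ⟨x, ?_⟩, ?_⟩
  · simp [hfx]
  · intro y hy
    by_contra hyU
    exact hy (by simp [hfU hyU])

/-- A disjoint family of non-empty open sets has a dense refinement by cozero sets. -/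
theorem IsCellular.exists_cozero_refinement [CompletelyRegularSpace X] {S : Set (Set X)}
    (hS : IsCellular S) : ∃ C : Set (Set X), IsCellular C ∧
      (∀ V ∈ C, ∃ g : X → ℝ, Continuous g ∧ Function.support g = V) ∧
      ∀ U, IsOpen U → ∀ R ∈ S, (U ∩ R).Nonempty → ∃ V ∈ C, V ⊆ R ∧ (U ∩ V).Nonempty := by
  obtain ⟨C, hC, hCP, hmax⟩ := exists_maximal_cellular
    (fun V : Set X => V.Nonempty ∧ (∃ R ∈ S, V ⊆ R) ∧
      ∃ g : X → ℝ, Continuous g ∧ Function.support g = V)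
    (fun V ⟨hne, _, g, hg, hgV⟩ => ⟨hgV ▸ hg.isOpen_support, hne⟩)
  refine ⟨C, hC, fun V hV => (hCP V hV).2.2, fun U hU R hR hne => ?_⟩
  -- By maximality a cozero set inside `U ∩ R` meets some `V ∈ C`; disjointness of `S` puts that `V`
  -- inside `R`.
  obtain ⟨g, hg, hgne, hgU⟩ := exists_support_subset (hU.inter (hS.isOpen R hR)) hne
  obtain ⟨V, hV, hgV⟩ := hmax _ ⟨hgne, ⟨R, hR, hgU.trans inter_subset_right⟩, g, hg, rfl⟩
  obtain ⟨R', hR', hVR'⟩ := (hCP V hV).2.1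
  have hRR' : R = R' := by
    by_contra hne'
    exact disjoint_left.1 (hS.disjoint hR hR' hne') (hgU hgV.some_mem.1).2 (hVR' hgV.some_mem.2)
  exact ⟨V, hV, hRR' ▸ hVR', hgV.mono (inter_subset_inter_left _ (hgU.trans inter_subset_left))⟩

/-- A shattering family gives a nowhere constant Tychonov image whose weight is bounded by a sum
of cardinalities of disjoint families. -/
theorem IsShattering.exists_image [CompletelyRegularSpace X] {F : Set (Set (Set X))}
    (hF : IsShattering F) : ∃ d : F → Cardinal.{u}, (∀ S, d S < hatCellularity X) ∧
      ∃ (Y : Type u) (_ : TopologicalSpace Y), IsTychonovNWCImage X Y ∧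
        weight Y ≤ max (Cardinal.sum d) ℵ₀ := by
  choose C hC g' hmeet using fun S : F => (hF.isCellular S S.2).exists_cozero_refinement
  choose g hg hsupp using g'
  refine ⟨fun S => #(C S), fun S => (hC S).card_lt, ?_⟩
  rw [← mk_sigma]
  refine exists_image_of_functions (I := Σ S : F, C S) (fun i => g i.1 i.2 i.2.2)
    (fun i => hg _ _ _) fun U hU hne => ?_
  obtain ⟨S, hS, R₁, hR₁, R₂, hR₂, hne', h₁, h₂⟩ := hF.shatters U hU hne
  obtain ⟨V, hV, hVR, x, hxU, hxV⟩ := hmeet ⟨S, hS⟩ U hU R₁ hR₁ h₁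
  obtain ⟨y, hyU, hyR⟩ := h₂
  refine ⟨⟨⟨S, hS⟩, V, hV⟩, x, hxU, y, hyU, fun h => ?_⟩
  have hx : x ∈ Function.support (g ⟨S, hS⟩ V hV) := by rwa [hsupp]
  have hy : y ∈ Function.support (g ⟨S, hS⟩ V hV) := by
    have hx' : g ⟨S, hS⟩ V hV x ≠ 0 := hx
    rw [h] at hx'
    exact hx'
  rw [hsupp] at hy
  exact disjoint_left.1 ((hF.isCellular S hS).disjoint hR₁ hR₂ hne') (hVR hy) hyR

/-- A shattering family of cardinality at most `ĉ(X)` gives an image of weight at most `ĉ(X)`. -/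
theorem IsShattering.exists_image_le [CompletelyRegularSpace X] (hω : ℵ₀ < hatCellularity X)
    {F : Set (Set (Set X))} (hF : IsShattering F) (hcard : #F ≤ hatCellularity X) :
    ∃ (Y : Type u) (_ : TopologicalSpace Y), IsTychonovNWCImage X Y ∧
      weight Y ≤ hatCellularity X := by
  obtain ⟨d, hd, Y, tY, hY, hw⟩ := hF.exists_image
  refine ⟨Y, tY, hY, hw.trans (max_le ?_ hω.le)⟩
  refine (sum_le_sum d (fun _ => hatCellularity X) fun S => (hd S).le).trans ?_
  rw [sum_const']
  exact (mul_le_mul_left hcard _).trans (mul_eq_self hω.le).le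

/-- A shattering family of cardinality less than `ĉ(X)` gives an image of weight less than
`ĉ(X)`. -/
theorem IsShattering.exists_image_lt [CompletelyRegularSpace X] (hω : ℵ₀ < hatCellularity X)
    {F : Set (Set (Set X))} (hF : IsShattering F) (hcard : #F < hatCellularity X) :
    ∃ (Y : Type u) (_ : TopologicalSpace Y), IsTychonovNWCImage X Y ∧
      weight Y < hatCellularity X := by
  obtain ⟨d, hd, Y, tY, hY, hw⟩ := hF.exists_image
  exact ⟨Y, tY, hY, hw.trans_lt (max_lt (sum_lt_hatCellularity_of_lt hω hcard hd) hω)⟩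

end Image

/-! ### Splitting regular open sets -/

section RegularOpen

variable {X : Type u} [TopologicalSpace X]

theorem IsRegularOpen.isOpen {U : Set X} (hU : IsRegularOpen U) : IsOpen U := by
  rw [← hU]
  exact isOpen_interior

theorem IsRegularOpen.subset_of_subset_closure {U V : Set X} (hV : IsRegularOpen V)
    (hU : IsOpen U) (h : U ⊆ closure V) : U ⊆ V := by
  rw [← hV]
  exact hU.subset_interior_iff.2 h

/-- This keeps the iterated splitting inside the regular open sets at limit stages. -/
theorem isRegularOpen_interior_iInter {ι : Sort*} {f : ι → Set X} (hf : ∀ i, IsRegularOpen (f i)) :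
    IsRegularOpen (interior (⋂ i, f i)) := by
  refine (interior_maximal (subset_iInter fun i => ?_) isOpen_interior).antisymm
    (interior_maximal subset_closure isOpen_interior)
  refine (hf i).subset_of_subset_closure isOpen_interior (interior_subset.trans ?_)
  exact closure_mono (interior_subset.trans (iInter_subset f i))

theorem isRegularOpen_interior_closure (U : Set X) : IsRegularOpen (interior (closure U)) := by
  refine (interior_mono ?_).antisymm (interior_maximal subset_closure isOpen_interior)
  exact closure_minimal interior_subset isClosed_closure

theorem IsRegularOpen.diff_closure {U V : Set X} (hU : IsRegularOpen U) (hV : IsOpen V) :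
    IsRegularOpen (U \ closure V) := by
  refine Subset.antisymm (fun x hx => ⟨?_, fun hxV => ?_⟩)
    (interior_maximal subset_closure (hU.isOpen.sdiff isClosed_closure))
  · rw [← hU]
    exact interior_mono (closure_mono sdiff_subset) hx
  · obtain ⟨y, hy, hyV⟩ := mem_closure_iff.1 hxV _ isOpen_interior hx
    obtain ⟨z, hzV, hz⟩ := mem_closure_iff.1 (interior_subset hy) V hV hyV
    exact hz.2 (subset_closure hzV)

/-- A splitting of every regular open set `W` into two disjoint regular open subsets `a W` and
`b W` with dense union, both non-empty if `W` is. -/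
structure IsSplitting (a b : Set X → Set X) : Prop where
  regularOpen_left : ∀ W, IsRegularOpen W → IsRegularOpen (a W)
  regularOpen_right : ∀ W, IsRegularOpen W → IsRegularOpen (b W)
  subset_left : ∀ W, IsRegularOpen W → a W ⊆ W
  subset_right : ∀ W, IsRegularOpen W → b W ⊆ W
  disjoint : ∀ W, IsRegularOpen W → Disjoint (a W) (b W)
  nonempty_left : ∀ W, IsRegularOpen W → W.Nonempty → (a W).Nonempty
  nonempty_right : ∀ W, IsRegularOpen W → W.Nonempty → (b W).Nonempty
  subset_left_of_disjoint : ∀ W U, IsRegularOpen W → IsOpen U → U ⊆ W → Disjoint U (b W) → U ⊆ a W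
  subset_right_of_disjoint : ∀ W U, IsRegularOpen W → U ⊆ W → IsOpen U → Disjoint U (a W) → U ⊆ b W

/-- Crowdedness gives two points of `W`. Separate them by `A` and `B` and regularize `A ∩ W`: its
closure still misses `B`. -/
theorem exists_isRegularOpen_subset [T2Space X] [PerfectSpace X] {W : Set X}
    (hW : IsRegularOpen W) (hne : W.Nonempty) :
    ∃ V ⊆ W, IsRegularOpen V ∧ V.Nonempty ∧ (W \ closure V).Nonempty := by
  obtain ⟨x, hx⟩ := hne
  obtain ⟨y, ⟨hy, -⟩, hyx⟩ := preperfect_iff_nhds.1 PerfectSpace.univ_preperfect x (mem_univ x) W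
    (hW.isOpen.mem_nhds hx)
  obtain ⟨A, B, hA, hB, hxA, hyB, hAB⟩ := t2_separation hyx.symm
  refine ⟨interior (closure (A ∩ W)), ?_, isRegularOpen_interior_closure _,
    ⟨x, interior_maximal subset_closure (hA.inter hW.isOpen) ⟨hxA, hx⟩⟩, y, hy, fun hy' => ?_⟩
  · rw [← hW]
    exact interior_mono (closure_mono (by rw [hW]; exact inter_subset_right))
  · have : y ∈ closure A := closure_mono inter_subset_left
      (closure_minimal interior_subset isClosed_closure hy')
    exact disjoint_left.1 (hAB.closure_left hB) this hyB

theorem exists_isSplitting [T2Space X] [PerfectSpace X] :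
    ∃ a b : Set X → Set X, IsSplitting a b := by
  have h : ∀ W : Set X, ∃ V, IsRegularOpen W → V ⊆ W ∧ IsRegularOpen V ∧
      (W.Nonempty → V.Nonempty ∧ (W \ closure V).Nonempty) := by
    intro W
    by_cases hW : IsRegularOpen W
    · rcases W.eq_empty_or_nonempty with rfl | hne
      · exact ⟨∅, fun _ => ⟨Subset.rfl, hW, fun h => (not_nonempty_empty h).elim⟩⟩
      · obtain ⟨V, h1, h2, h3⟩ := exists_isRegularOpen_subset hW hne
        exact ⟨V, fun _ => ⟨h1, h2, fun _ => h3⟩⟩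
    · exact ⟨∅, fun h => (hW h).elim⟩
  choose a ha using h
  refine ⟨a, fun W => W \ closure (a W), ⟨fun W hW => (ha W hW).2.1,
    fun W hW => hW.diff_closure (ha W hW).2.1.isOpen, fun W hW => (ha W hW).1,
    fun W hW => sdiff_subset, fun W hW => ?_, fun W hW hne => ((ha W hW).2.2 hne).1,
    fun W hW hne => ((ha W hW).2.2 hne).2, fun W U hW hU hUW hd => ?_,
    fun W U hW hUW hU hd => ?_⟩⟩
  · exact disjoint_sdiff_right.mono_left subset_closure
  · refine (ha W hW).2.1.subset_of_subset_closure hU fun x hx => ?_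
    by_contra hx'
    exact disjoint_left.1 hd hx ⟨hUW hx, hx'⟩
  · exact fun x hx => ⟨hUW hx, disjoint_left.1 (hd.closure_right hU) hx⟩

end RegularOpen

/-! ### The tree of iterated parts -/

section Nodes

variable {X : Type u} [TopologicalSpace X] {a b c c' : Set X → Set X}

/-- `c` selects one of the two parts `a W` and `b W` of each set `W`. -/
def IsSelection (a b c : Set X → Set X) : Prop :=
  ∀ W, c W = a W ∨ c W = b W

/-- The decreasing transfinite sequence obtained by iterating `c`. -/
noncomputable def node (c : Set X → Set X) (α : Ordinal.{u}) : Set X :=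
  interior (⋂ β : Iio α, c (node c β))
termination_by α
decreasing_by exact β.2

/-- At `α = 0` the intersection is empty, so the root is the whole space. -/
theorem node_eq (c : Set X → Set X) (α : Ordinal.{u}) :
    node c α = interior (⋂ β : Iio α, c (node c β)) := by
  rw [node]

theorem node_subset_of_lt {α β : Ordinal.{u}} (h : β < α) : node c α ⊆ c (node c β) := by
  rw [node_eq c α]
  exact interior_subset.trans (iInter_subset (fun β : Iio α => c (node c β)) ⟨β, h⟩)

theorem node_congr {α : Ordinal.{u}} (h : ∀ β < α, c (node c β) = c' (node c' β)) :
    node c α = node c' α := by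
  rw [node_eq c, node_eq c']
  exact congrArg interior (iInter_congr fun β => h β β.2)

theorem IsSelection.isRegularOpen (hc : IsSelection a b c) (hab : IsSplitting a b) {W : Set X}
    (hW : IsRegularOpen W) : IsRegularOpen (c W) := by
  rcases hc W with h | h <;> rw [h]
  exacts [hab.regularOpen_left W hW, hab.regularOpen_right W hW]

theorem IsSelection.subset (hc : IsSelection a b c) (hab : IsSplitting a b) {W : Set X}
    (hW : IsRegularOpen W) : c W ⊆ W := by
  rcases hc W with h | h <;> rw [h]
  exacts [hab.subset_left W hW, hab.subset_right W hW]

theorem IsSelection.ssubset (hc : IsSelection a b c) (hab : IsSplitting a b) {W : Set X}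
    (hW : IsRegularOpen W) (hne : W.Nonempty) : c W ⊂ W := by
  refine (hc.subset hab hW).ssubset_of_ne fun heq => ?_
  have hd := hab.disjoint W hW
  rcases hc W with h | h
  · obtain ⟨x, hx⟩ := hab.nonempty_right W hW hne
    exact disjoint_left.1 hd ((h.symm.trans heq).ge (hab.subset_right W hW hx)) hx
  · obtain ⟨x, hx⟩ := hab.nonempty_left W hW hne
    exact disjoint_left.1 hd hx ((h.symm.trans heq).ge (hab.subset_left W hW hx))

theorem IsSelection.isRegularOpen_node (hc : IsSelection a b c) (hab : IsSplitting a b)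
    (α : Ordinal.{u}) : IsRegularOpen (node c α) := by
  induction α using WellFoundedLT.induction with
  | ind α ih =>
    rw [node_eq]
    exact isRegularOpen_interior_iInter fun β => hc.isRegularOpen hab (ih β β.2)

theorem IsSelection.node_anti (hc : IsSelection a b c) (hab : IsSplitting a b)
    {α β : Ordinal.{u}} (h : β ≤ α) : node c α ⊆ node c β := by
  rcases h.eq_or_lt with rfl | h
  · exact Subset.rfl
  · exact (node_subset_of_lt h).trans (hc.subset hab (hc.isRegularOpen_node hab β))

theorem IsSelection.node_ssubset (hc : IsSelection a b c) (hab : IsSplitting a b)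
    {α β : Ordinal.{u}} (h : β < α) (hne : (node c α).Nonempty) : node c α ⊂ node c β :=
  (node_subset_of_lt h).trans_ssubset (hc.ssubset hab (hc.isRegularOpen_node hab β)
    (hne.mono (hc.node_anti hab h.le)))

/-- Consider the first stage below `α` where the choices differ. The nodes agree there, and then one
sequence enters `a` and the other `b`. -/
theorem IsSelection.node_eq_or_disjoint (hc : IsSelection a b c) (hc' : IsSelection a b c')
    (hab : IsSplitting a b) {α α' : Ordinal.{u}} (h : α ≤ α') :
    node c α = node c' α ∨ Disjoint (node c α) (node c' α') := by
  by_cases hagree : ∀ β < α, c (node c β) = c' (node c' β)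
  · exact Or.inl (node_congr hagree)
  · push Not at hagree
    obtain ⟨β, ⟨hβ, hne⟩, hmin⟩ := (wellFounded_lt (α := Ordinal.{u})).has_min
      {β | β < α ∧ c (node c β) ≠ c' (node c' β)} hagree
    have heq : node c β = node c' β := node_congr fun γ hγ => by
      by_contra h'
      exact hmin γ ⟨hγ.trans hβ, h'⟩ hγ
    right
    refine Disjoint.mono (node_subset_of_lt hβ) (node_subset_of_lt (hβ.trans_le h)) ?_
    have hd := hab.disjoint _ (hc.isRegularOpen_node hab β)
    rw [← heq] at hne ⊢
    rcases hc (node c β) with h1 | h1 <;> rcases hc' (node c β) with h2 | h2 <;>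
      rw [h1, h2] at hne ⊢
    exacts [(hne rfl).elim, hd, hd.symm, (hne rfl).elim]

/-- The tree of all non-empty iterated parts of the whole space. -/
def nodes (a b : Set X → Set X) : Set (Set X) :=
  {W | W.Nonempty ∧ ∃ c, IsSelection a b c ∧ ∃ α : Ordinal.{u}, node c α = W}

theorem IsSplitting.isRegularOpen_of_mem_nodes (hab : IsSplitting a b) {W : Set X}
    (hW : W ∈ nodes a b) : IsRegularOpen W := by
  obtain ⟨-, c, hc, α, rfl⟩ := hW
  exact hc.isRegularOpen_node hab α

theorem IsSelection.lt_of_node_ssubset (hc : IsSelection a b c) (hc' : IsSelection a b c')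
    (hab : IsSplitting a b) {α α' : Ordinal.{u}} (hne : (node c' α').Nonempty)
    (h : node c' α' ⊂ node c α) : α < α' ∧ node c α = node c' α := by
  have hnd : ¬ Disjoint (node c' α') (node c α) := fun hd =>
    hne.ne_empty (disjoint_self.1 (hd.mono_right h.1))
  rcases lt_or_ge α α' with hlt | hle
  · exact ⟨hlt, (hc.node_eq_or_disjoint hc' hab hlt.le).resolve_right fun hd => hnd hd.symm⟩
  · have := (hc'.node_eq_or_disjoint hc hab hle).resolve_right hnd
    exact (h.2 (this ▸ hc.node_anti hab hle)).elim

theorem IsSplitting.subset_or_subset_or_disjoint (hab : IsSplitting a b) {V W : Set X}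
    (hV : V ∈ nodes a b) (hW : W ∈ nodes a b) : V ⊆ W ∨ W ⊆ V ∨ Disjoint V W := by
  obtain ⟨-, c, hc, α, rfl⟩ := hV
  obtain ⟨-, c', hc', α', rfl⟩ := hW
  rcases le_total α α' with h | h
  · rcases hc.node_eq_or_disjoint hc' hab h with heq | hd
    · exact Or.inr (Or.inl (heq ▸ hc'.node_anti hab h))
    · exact Or.inr (Or.inr hd)
  · rcases hc'.node_eq_or_disjoint hc hab h with heq | hd
    · exact Or.inl (heq ▸ hc.node_anti hab h)
    · exact Or.inr (Or.inr hd.symm)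

theorem IsSplitting.subset_part (hab : IsSplitting a b) {V W : Set X}
    (hV : V ∈ nodes a b) (hW : W ∈ nodes a b) (h : W ⊂ V) : W ⊆ a V ∨ W ⊆ b V := by
  obtain ⟨-, c, hc, α, rfl⟩ := hV
  obtain ⟨hne, c', hc', α', rfl⟩ := hW
  obtain ⟨hlt, heq⟩ := hc.lt_of_node_ssubset hc' hab hne h
  have hsub := node_subset_of_lt (c := c') hlt
  rw [← heq] at hsub
  rcases hc' (node c α) with h' | h' <;> rw [h'] at hsub
  exacts [Or.inl hsub, Or.inr hsub]

/-- The members of a chain of nodes, except for the smallest one, have disjoint non-empty parts. -/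
theorem IsSplitting.card_chain_lt (hab : IsSplitting a b) (hω : ℵ₀ < hatCellularity X)
    {C : Set (Set X)} (hC : C ⊆ nodes a b) (hchain : IsChain (· ⊆ ·) C) :
    #C < hatCellularity X := by
  let C' : Set (Set X) := {V ∈ C | ∃ W ∈ C, W ⊂ V}
  -- `D` is the part of `V` that the chain does not enter: smaller members are non-empty and
  -- comparable, so they all lie in the same part.
  have hpart : ∀ V : C', ∃ D : Set X, IsOpen D ∧ D.Nonempty ∧ D ⊆ V ∧
      ∀ W ∈ C, W ⊂ (V : Set X) → Disjoint D W := by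
    rintro ⟨V, hV, W, hW, hWV⟩
    have hreg := hab.isRegularOpen_of_mem_nodes (hC hV)
    have hVne := (hC hV).1
    have hWne := (hC hW).1
    have hd := hab.disjoint V hreg
    have key : ∀ p q : Set X, Disjoint p q → W ⊆ p →
        (∀ W' ∈ C, W' ⊂ V → W' ⊆ p ∨ W' ⊆ q) → ∀ W' ∈ C, W' ⊂ V → Disjoint q W' := by
      intro p q hpq hWp hsub W' hW' hW'V
      refine (hpq.mono_left ?_).symm
      rcases hsub W' hW' hW'V with h | h
      · exact h
      · obtain ⟨x, hx⟩ := (hC hW').1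
        obtain ⟨y, hy⟩ := hWne
        rcases hchain.total hW hW' with hle | hle
        · exact (disjoint_left.1 hpq (hWp hy) (h (hle hy))).elim
        · exact hle.trans hWp
    rcases hab.subset_part (hC hV) (hC hW) hWV with h | h
    · exact ⟨b V, (hab.regularOpen_right V hreg).isOpen, hab.nonempty_right V hreg hVne,
        hab.subset_right V hreg, key _ _ hd h fun W' hW' => hab.subset_part (hC hV) (hC hW')⟩
    · exact ⟨a V, (hab.regularOpen_left V hreg).isOpen, hab.nonempty_left V hreg hVne,
        hab.subset_left V hreg, key _ _ hd.symm h fun W' hW' hW'V =>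
          (hab.subset_part (hC hV) (hC hW') hW'V).symm⟩
  choose D hDo hDne hDV hDW using hpart
  have hdis : ∀ V W : C', V ≠ W → Disjoint (D V) (D W) := by
    have aux : ∀ V W : C', V ≠ W → (W : Set X) ⊆ V → Disjoint (D V) (D W) := fun V W hne h =>
      (hDW V W W.2.1 (h.ssubset_of_ne fun h' => hne (Subtype.ext h'.symm))).mono_right (hDV W)
    intro V W hne
    rcases hchain.total V.2.1 W.2.1 with h | h
    · exact (aux W V hne.symm h).symm
    · exact aux V W hne h
  have hinj : Function.Injective D := fun V W hVW => by
    by_contra h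
    have h' := hdis V W h
    rw [hVW] at h'
    exact (hDne W).ne_empty (disjoint_self.1 h')
  have hcell : IsCellular (range D) := by
    refine ⟨?_, ?_, ?_⟩
    · rintro _ ⟨V, rfl⟩
      exact hDo V
    · rintro _ ⟨V, rfl⟩
      exact hDne V
    · rintro _ ⟨V, rfl⟩ _ ⟨W, rfl⟩ h
      exact hdis V W fun h' => h (by rw [h'])
  have hC' : #C' < hatCellularity X := by
    rw [← mk_range_eq D hinj]
    exact hcell.card_lt
  have hdiff : (C \ C').Subsingleton := by
    rintro V ⟨hV, hV'⟩ W ⟨hW, hW'⟩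
    by_contra hne
    rcases hchain.total hV hW with h | h
    · exact hW' ⟨hW, V, hV, h.ssubset_of_ne hne⟩
    · exact hV' ⟨hV, W, hW, h.ssubset_of_ne (Ne.symm hne)⟩
  have hle : #C ≤ #C' + #(C \ C' : Set (Set X)) := by
    rw [← union_sdiff_cancel (show C' ⊆ C from fun V hV => hV.1)]
    refine (mk_union_le _ _).trans ?_
    simp
  refine hle.trans_lt (add_lt_of_lt hω.le hC' (lt_of_le_of_lt ?_ hω))
  exact (mk_le_one_iff_set_subsingleton.2 hdiff).trans one_le_aleph0

/-- Incomparable nodes are disjoint, so an antichain is a disjoint family. -/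
theorem IsSplitting.card_antichain_lt (hab : IsSplitting a b) {A : Set (Set X)}
    (hA : A ⊆ nodes a b) (hanti : IsAntichain (· ⊆ ·) A) : #A < hatCellularity X := by
  refine IsCellular.card_lt ⟨fun V hV => (hab.isRegularOpen_of_mem_nodes (hA hV)).isOpen,
    fun V hV => (hA hV).1, fun V hV W hW hne => ?_⟩
  rcases hab.subset_or_subset_or_disjoint (hA hV) (hA hW) with h | h | h
  · exact (hanti hV hW hne h).elim
  · exact (hanti hW hV hne.symm h).elim
  · exact h

/-- The tree of nodes has a rank function with values below `ĉ(X)`. -/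
theorem IsSplitting.exists_rank (hab : IsSplitting a b) (hω : ℵ₀ < hatCellularity X) :
    ∃ r : nodes a b → Ordinal.{u}, (∀ W, r W < (hatCellularity X).ord) ∧
      ∀ V W : nodes a b, (W : Set X) ⊂ V → r V < r W := by
  choose hne c hc r hr using fun W : nodes a b => W.2
  refine ⟨r, fun W => ?_, fun V W h => ?_⟩
  · rw [lt_ord]
    -- The earlier nodes on the way to `W` form a chain indexed injectively by `r W`, so the chain
    -- bound limits `r W`.
    have hnodes : ∀ β : Iio (r W), (node (c W) (r W)) ⊂ (node (c W) β) := fun β =>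
      (hc W).node_ssubset hab β.2 (by rw [hr]; exact hne W)
    have hC : range (fun β : Iio (r W) => node (c W) β) ⊆ nodes a b := by
      rintro _ ⟨β, rfl⟩
      exact ⟨((hr W).symm ▸ hne W).mono (hnodes β).1, c W, hc W, β, rfl⟩
    have hinj : Function.Injective fun β : Iio (r W) => node (c W) β := by
      have aux : ∀ β γ : Iio (r W), β < γ → node (c W) γ ≠ node (c W) β := fun β γ h =>
        ((hc W).node_ssubset hab h (((hr W).symm ▸ hne W).mono (hnodes γ).1)).ne
      intro β γ h
      rcases lt_trichotomy β γ with hlt | heq | hlt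
      · exact (aux _ _ hlt h.symm).elim
      · exact heq
      · exact (aux _ _ hlt h).elim
    have hchain : IsChain (· ⊆ ·) (range fun β : Iio (r W) => node (c W) β) := by
      rintro _ ⟨β, rfl⟩ _ ⟨γ, rfl⟩ -
      rcases le_total β γ with h | h
      · exact Or.inr ((hc W).node_anti hab h)
      · exact Or.inl ((hc W).node_anti hab h)
    have hlt := hab.card_chain_lt hω hC hchain
    have hcard := mk_range_eq_of_injective hinj
    rw [mk_Iio_ordinal, Cardinal.lift_lift] at hcard
    rwa [← Cardinal.lift_inj.1 hcard]
  · rw [← hr V, ← hr W] at h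
    exact ((hc V).lt_of_node_ssubset (hc W) hab (by rw [hr]; exact hne W) h).1

/-- There are at most `ĉ(X)` ranks, and nodes of equal rank form an antichain. -/
theorem IsSplitting.card_nodes_le (hab : IsSplitting a b) (hω : ℵ₀ < hatCellularity X) :
    #(nodes a b) ≤ hatCellularity X := by
  obtain ⟨r, hr, hmono⟩ := hab.exists_rank hω
  refine (card_le_of_fiber_le (fun W => Ordinal.ToType.mk ⟨r W, hr W⟩)
    (μ := hatCellularity X) fun o => ?_).trans ?_
  · have hinj : Function.Injective fun W : {W : nodes a b //
        Ordinal.ToType.mk ⟨r W, hr W⟩ = o} => (W : Set X) :=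
      fun V W h => Subtype.ext (Subtype.ext h)
    rw [← mk_range_eq _ hinj]
    refine (hab.card_antichain_lt ?_ ?_).le
    · rintro _ ⟨W, rfl⟩
      exact W.1.2
    · rintro _ ⟨V, rfl⟩ _ ⟨W, rfl⟩ hne h
      have hlt := hmono W V (LE.le.ssubset_of_ne h hne)
      have heq := congrArg Subtype.val (Ordinal.ToType.mk.injective (W.2.trans V.2.symm))
      exact hlt.ne heq
  · rw [mk_ord_toType]
    exact (mul_eq_self hω.le).le

/-- The pairs of parts of the nodes form a shattering family. -/
theorem IsSplitting.isShattering (hab : IsSplitting a b) :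
    IsShattering ((fun W => ({a W, b W} : Set (Set X))) '' nodes a b) := by
  refine ⟨?_, ?_, fun U hU hne => ?_⟩
  · rintro _ ⟨W, hW, rfl⟩
    have hreg := hab.isRegularOpen_of_mem_nodes hW
    refine ⟨?_, ?_, ?_⟩
    · rintro _ (rfl | rfl)
      exacts [(hab.regularOpen_left W hreg).isOpen, (hab.regularOpen_right W hreg).isOpen]
    · rintro _ (rfl | rfl)
      exacts [hab.nonempty_left W hreg hW.1, hab.nonempty_right W hreg hW.1]
    · rintro _ (rfl | rfl) _ (rfl | rfl) h
      exacts [(h rfl).elim, hab.disjoint W hreg, (hab.disjoint W hreg).symm, (h rfl).elim]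
  · rintro _ ⟨W, hW, rfl⟩ _ (rfl | rfl)
    · exact hab.regularOpen_left W (hab.isRegularOpen_of_mem_nodes hW)
    · exact hab.regularOpen_right W (hab.isRegularOpen_of_mem_nodes hW)
  · by_contra! hcon
    have hcon' : ∀ W ∈ nodes a b, U ⊆ W → U ⊆ a W ∨ U ⊆ b W := by
      intro W hW hUW
      have hreg := hab.isRegularOpen_of_mem_nodes hW
      by_cases h : (U ∩ a W).Nonempty
      · refine Or.inl (hab.subset_left_of_disjoint W U hreg hU hUW (disjoint_iff_inter_eq_empty.2
          (hcon _ ⟨W, hW, rfl⟩ (a W) (by simp) (b W) (by simp) (fun heq => ?_) h)))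
        have hd := hab.disjoint W hreg
        rw [← heq] at hd
        exact (hab.nonempty_left W hreg hW.1).ne_empty (disjoint_self.1 hd)
      · exact Or.inr (hab.subset_right_of_disjoint W U hreg hUW hU
          (disjoint_iff_inter_eq_empty.2 (not_nonempty_iff_eq_empty.1 h)))
    classical
    -- Following the unsplit `U` gives nodes that always contain `U`, hence strictly decrease along
    -- all ordinals. That would inject the ordinals into `Set X`.
    let c : Set X → Set X := fun W => if U ⊆ a W then a W else b W
    have hc : IsSelection a b c := fun W => by
      by_cases h : U ⊆ a W <;> simp [c, h]
    have hsub : ∀ α, U ⊆ node c α := by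
      intro α
      induction α using WellFoundedLT.induction with
      | ind α ih =>
        rw [node_eq]
        refine interior_maximal (subset_iInter fun β => ?_) hU
        have := hcon' _ ⟨hne.mono (ih β β.2), c, hc, β, rfl⟩ (ih β β.2)
        by_cases h : U ⊆ a (node c β)
        · simp [c, h]
        · simpa [c, h] using this.resolve_left h
    refine not_injective_of_ordinal (node c) fun α β h => ?_
    rcases lt_trichotomy α β with hlt | heq | hlt
    · exact ((hc.node_ssubset hab hlt (hne.mono (hsub _))).ne h.symm).elim
    · exact heq
    · exact ((hc.node_ssubset hab hlt (hne.mono (hsub _))).ne h).elim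

/-- If there are `ĉ(X)` many nodes, they form a Suslin tree under reverse inclusion. -/
theorem IsSplitting.isSuslinTree (hab : IsSplitting a b) (hω : ℵ₀ < hatCellularity X)
    (hcard : #(nodes a b) = hatCellularity X) :
    IsSuslinTree (hatCellularity X) (nodes a b)ᵒᵈ := by
  obtain ⟨r, -, hmono⟩ := hab.exists_rank hω
  have hval : Function.Injective fun W : (nodes a b)ᵒᵈ => ((OrderDual.ofDual W : nodes a b) : Set X) :=
    fun V W h => Subtype.ext h
  refine ⟨fun t => ?_, hcard, fun C hC => ?_, fun A hA => ?_⟩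
  · have hwf : WellFounded fun V W : (nodes a b)ᵒᵈ => V < W :=
      Subrelation.wf (fun {V W} h => hmono V W h) (InvImage.wf r wellFounded_lt)
    refine { wf := InvImage.wf Subtype.val hwf, trichotomous := fun V W h1 h2 => ?_ }
    by_contra hne
    let val : (nodes a b)ᵒᵈ → Set X := fun W => (OrderDual.ofDual W : nodes a b)
    have hne' : val V ≠ val W := fun h => hne (Subtype.ext (hval h))
    rcases hab.subset_or_subset_or_disjoint V.1.2 W.1.2 with h | h | h
    · exact h2 (show val V ⊂ val W from LE.le.ssubset_of_ne h hne')
    · exact h1 (show val W ⊂ val V from LE.le.ssubset_of_ne h hne'.symm)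
    -- Predecessors of `t` in the reversed order contain the non-empty set `t`, so they cannot be
    -- disjoint.
    · obtain ⟨x, hx⟩ := t.2.1
      have hV : val t ⊆ val V := (show V.1 < t from V.2).le
      have hW : val t ⊆ val W := (show W.1 < t from W.2).le
      exact disjoint_left.1 h (hV hx) (hW hx)
  · rw [← mk_image_eq hval]
    refine hab.card_chain_lt hω ?_ ?_
    · rintro _ ⟨W, -, rfl⟩
      exact W.2
    · rintro _ ⟨V, hV, rfl⟩ _ ⟨W, hW, rfl⟩ hne
      exact (hC hV hW fun h => hne (by rw [h])).symm
  · rw [← mk_image_eq hval]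
    refine hab.card_antichain_lt ?_ ?_
    · rintro _ ⟨W, -, rfl⟩
      exact W.2
    · rintro _ ⟨V, hV, rfl⟩ _ ⟨W, hW, rfl⟩ hne h
      exact hA hW hV (fun h => hne (by rw [h])) h

end Nodes

end NowhereConst

/-! ### The theorem -/

theorem mainTheorem1 (X : Type u) [TopologicalSpace X] [T35Space X] [PerfectSpace X] :
    (∃ (Y : Type u) (_ : TopologicalSpace Y), NowhereConst.IsTychonovNWCImage X Y ∧
      NowhereConst.weight Y ≤ NowhereConst.hatCellularity X) ∧
    (NowhereConst.shatteringNumber X < NowhereConst.hatCellularity X →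
      ∃ (Y : Type u) (_ : TopologicalSpace Y), NowhereConst.IsTychonovNWCImage X Y ∧
        NowhereConst.weight Y < NowhereConst.hatCellularity X) ∧
    ((∀ (T : Type u) [PartialOrder T],
        ¬ NowhereConst.IsSuslinTree (NowhereConst.hatCellularity X) T) →
      NowhereConst.shatteringNumber X < NowhereConst.hatCellularity X ∧
      ∃ (Y : Type u) (_ : TopologicalSpace Y), NowhereConst.IsTychonovNWCImage X Y ∧
        NowhereConst.weight Y < NowhereConst.hatCellularity X) := by
  open NowhereConst in
  -- For empty `X` the bound `ℵ₀ < ĉ(X)` fails, but `X` itself, of weight `0`, serves as `Y`.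
  rcases isEmpty_or_nonempty X with hX | hX
  · have hpos : 0 < hatCellularity X := by
      rw [← hatCellularityIn_univ]
      exact hatCellularityIn_pos _
    have hsh : shatteringNumber X = 0 := le_antisymm (csInf_le' ⟨∅, ⟨by simp, by simp,
      fun U _ hU => (isEmptyElim hU.some)⟩, by simp⟩) zero_le
    have hw : weight X = 0 := le_antisymm (csInf_le' ⟨∅, by
      refine isTopologicalBasis_of_isOpen_of_nhds (by simp) fun x => isEmptyElim x, by simp⟩)
      zero_le
    have hY : ∃ (Y : Type u) (_ : TopologicalSpace Y), IsTychonovNWCImage X Y ∧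
        weight Y < hatCellularity X := ⟨X, inferInstance, ⟨inferInstance, inferInstance, id,
      ⟨continuous_id, fun U _ hU => isEmptyElim hU.some⟩, Function.surjective_id⟩, hw ▸ hpos⟩
    exact ⟨let ⟨Y, tY, h1, h2⟩ := hY; ⟨Y, tY, h1, h2.le⟩, fun _ => hY, fun _ => ⟨hsh ▸ hpos, hY⟩⟩
  have : Infinite X :=
    infinite_univ_iff.1 (infinite_of_mem_nhds (Classical.arbitrary X) Filter.univ_mem)
  have hω : ℵ₀ < hatCellularity X := aleph0_lt_hatCellularity
  obtain ⟨a, b, hab⟩ := exists_isSplitting (X := X)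
  have hF := hab.isShattering
  have hFcard := mk_image_le (f := fun W => ({a W, b W} : Set (Set X))) (s := nodes a b)
  have himage : shatteringNumber X < hatCellularity X →
      ∃ (Y : Type u) (_ : TopologicalSpace Y), IsTychonovNWCImage X Y ∧
        weight Y < hatCellularity X := fun h => by
    -- The family built from the nodes shows that the infimum is over a non-empty set, so it is
    -- attained and is not the default `0`.
    obtain ⟨F, hF, hcard⟩ := csInf_mem (s := {κ | ∃ F : Set (Set (Set X)), IsShattering F ∧ #F = κ})
      ⟨_, _, hF, rfl⟩
    exact hF.exists_image_lt hω (hcard.trans_lt h)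
  refine ⟨hF.exists_image_le hω (hFcard.trans (hab.card_nodes_le hω)), himage, fun hS => ?_⟩
  have hlt : #(nodes a b) < hatCellularity X := (hab.card_nodes_le hω).lt_of_ne fun h =>
    hS _ (hab.isSuslinTree hω h)
  have hsh : shatteringNumber X < hatCellularity X :=
    (csInf_le' ⟨_, hF, rfl⟩ : shatteringNumber X ≤ _).trans_lt (hFcard.trans_lt hlt)
  exact ⟨hsh, himage hsh⟩
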